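/- Let $\mathcal{C}$ be a braided monoidal category with unit object $I$ and braiding $\psi$; the braiding is not assumed to be symmetric. (In the intended applications $\mathcal{C}$ is moreover abelian, but no additive structure is needed.) Associativity and unit constraints are suppressed, $H^n$ denotes $H^{\otimes n}$ with $H^0=I$, and $(f,g,\dots)$ denotes $f\otimes g\otimes\cdots$. Let $(H,m,\eta,\Delta,\varepsilon,S)$ be a Hopf algebra in $\mathcal{C}$. Let $\delta:H\to I$ be a character (an algebra map: $\delta m=\delta\otimes\delta$, $\delta\eta=\mathrm{id}_I$) and $\sigma:I\to H$ a co-character (a coalgebra map: $\Delta\sigma=\sigma\otimes\sigma$, $\varepsilon\sigma=\mathrm{id}_I$), and put $\widetilde S=(\delta\otimes S)\Delta$. Suppose that $(\delta,\sigma)$ is a braided modular pair in involution, i.e. $\delta\sigma=\mathrm{id}_I$ and $m(m\otimes \mathrm{id})(S\sigma\otimes\widetilde S^2\otimes\sigma)=\mathrm{id}_H$. Then the objects $C^0=I$ and $C^n=H^{n}$ $(n\ge 1)$, with the faces $\delta_i:C^{n-1}\to C^n$ $(n\geq 1,\ 0\le i\le n)$, degeneracies $\sigma_i:C^{n+1}\to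 C^n$ $(n\ge 0,\ 0\le i\le n)$ and cyclic operators $\tau_n:C^n\to C^n$ given by \[ \delta_i=\begin{cases}(\eta,1,\dots,1), & i=0,\\ (1,\dots,1,\Delta,1,\dots,1)\ \text{with } \Delta \text{ on the } i\text{-th factor}, & 1\le i\le n-1,\\ (1,\dots,1,\sigma), & i=n,\end{cases} \] \[ \sigma_i=(1,\dots,1,\varepsilon,1,\dots,1)\ \text{with } \varepsilon \text{ on the } (i+1)\text{-th factor}, \] \[ \tau_0=\mathrm{id}_I,\qquad \tau_n=m_n\,(\Delta^{n-1}\widetilde S,\,1_{H^{n-1}},\,\sigma)\quad (n\ge 1), \] form a para-cocyclic object in $\mathcal{C}$. Here $\Delta^{n-1}:H\to H^n$ is the iterated comultiplication, $m_1=m$, and for $n\ge 2$ \[ m_n=(\underbrace{m,\dots,m}_{n})\,\mathcal F_n(\psi),\qquad \mathcal F_n(\psi)=\prod_{j=1}^{n-1}(1_{H^j},\underbrace{\psi_{H,H},\dots,\psi_{H,H}}_{n-j},1_{H^j}), \] where in the product of morphisms the factor $j=1$ stands leftmost, so that the factor $j=n-1$ is applied first. A para-cocyclic object is a collection $(C^n,\delta_i,\sigma_i,\tau_n)_{n\ge0}$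 that satisfies all axioms of a cocyclic object except $\tau_n^{n+1}=\mathrm{id}$; that is, it satisfies the cosimplicial identities together with \[ \tau_n\delta_0=\delta_n,\quad \tau_n\delta_i=\delta_{i-1}\tau_{n-1}\ (1\le i\le n),\quad \tau_n\sigma_0=\sigma_n\tau_{n+1}^2,\quad \tau_n\sigma_i=\sigma_{i-1}\tau_{n+1}\ (1\le i\le n). \] -/

import Mathlib

open CategoryTheory MonoidalCategory
open scoped MonObj ComonObj HopfObj

universe v u

/-! ### Para-cocyclic objects -/

/-- A para-cocyclic object in a category: objects `X n` (`n ≥ 0`), cofaces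
`d n i : X n ⟶ X (n+1)` (`0 ≤ i ≤ n+1`), codegeneracies `s n i : X (n+1) ⟶ X n` (`0 ≤ i ≤ n`) and
cyclic operators `t n : X n ⟶ X n`, subject to all the axioms of a cocyclic object except
`(t n) ^ (n+1) = 𝟙`. Compositions are written in diagrammatic order (`f ≫ g` is `g ∘ f`). -/
structure IsParaCocyclic {C : Type u} [Category.{v} C] (X : ℕ → C)
    (d : ∀ n : ℕ, Fin (n + 2) → (X n ⟶ X (n + 1)))
    (s : ∀ n : ℕ, Fin (n + 1) → (X (n + 1) ⟶ X n))
    (t : ∀ n : ℕ, X n ⟶ X n) : Prop where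
  /-- `d_{j+1} d_i = d_i d_j` for `i ≤ j`. -/
  d_comp_d : ∀ (n : ℕ) (i j : Fin (n + 2)), i ≤ j →
    d n i ≫ d (n + 1) j.succ = d n j ≫ d (n + 1) i.castSucc
  /-- `s_{j+1} d_i = d_i s_j` for `i ≤ j`. -/
  d_comp_s_of_le : ∀ (n : ℕ) (i : Fin (n + 2)) (j : Fin (n + 1)), i ≤ j.castSucc →
    d (n + 1) i.castSucc ≫ s (n + 1) j.succ = s n j ≫ d n i
  /-- `s_i d_i = 1`. -/
  d_comp_s_self : ∀ (n : ℕ) (i : Fin (n + 1)), d n i.castSucc ≫ s n i = 𝟙 (X n)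
  /-- `s_i d_{i+1} = 1`. -/
  d_comp_s_succ : ∀ (n : ℕ) (i : Fin (n + 1)), d n i.succ ≫ s n i = 𝟙 (X n)
  /-- `s_j d_{i+1} = d_i s_j` for `j < i`. -/
  d_comp_s_of_gt : ∀ (n : ℕ) (i : Fin (n + 2)) (j : Fin (n + 1)), j.castSucc < i →
    d (n + 1) i.succ ≫ s (n + 1) j.castSucc = s n j ≫ d n i
  /-- `s_j s_i = s_i s_{j+1}` for `i ≤ j`. -/
  s_comp_s : ∀ (n : ℕ) (i j : Fin (n + 1)), i ≤ j →
    s (n + 1) i.castSucc ≫ s n j = s (n + 1) j.succ ≫ s n i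
  /-- `t_{n+1} d_0 = d_{n+1}`. -/
  d_zero_comp_t : ∀ n : ℕ, d n 0 ≫ t (n + 1) = d n (Fin.last (n + 1))
  /-- `t_{n+1} d_{i+1} = d_i t_n` for `0 ≤ i ≤ n`. -/
  d_succ_comp_t : ∀ (n : ℕ) (i : Fin (n + 1)),
    d n i.succ ≫ t (n + 1) = t n ≫ d n i.castSucc
  /-- `t_n s_0 = s_n t_{n+1}²`. -/
  s_zero_comp_t : ∀ n : ℕ, s n 0 ≫ t n = t (n + 1) ≫ t (n + 1) ≫ s n (Fin.last n)
  /-- `t_n s_{i+1} = s_i t_{n+1}` for `0 ≤ i < n`. -/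
  s_succ_comp_t : ∀ (n : ℕ) (i : Fin n),
    s n i.succ ≫ t n = t (n + 1) ≫ s n i.castSucc

namespace BraidedHopf

variable {C : Type u} [Category.{v} C] [MonoidalCategory C]

/-- The tensor power `H^{⊗n} = H ⊗ (H ⊗ (⋯ ⊗ (H ⊗ I)))`, with `H^{⊗0} = I`. -/
def tensorPow (H : C) : ℕ → C
  | 0 => 𝟙_ C
  | n + 1 => H ⊗ tensorPow H n

/-- The canonical isomorphism `H^{⊗a} ⊗ H^{⊗b} ≅ H^{⊗(b+a)}` built from the constraints. -/
def concatIso (H : C) (b : ℕ) : (a : ℕ) → (tensorPow H a ⊗ tensorPow H b ≅ tensorPow H (b + a))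
  | 0 => λ_ (tensorPow H b)
  | a + 1 => α_ H (tensorPow H a) (tensorPow H b) ≪≫ whiskerLeftIso H (concatIso H b a)

section Braided

variable [BraidedCategory C]

/-- `(ψ, …, ψ, 1, …, 1)` on `H^{⊗N}`: the braiding on each of the first `k` consecutive pairs of
tensor factors. -/
def braidPairs (H : C) : (N k : ℕ) → (tensorPow H N ⟶ tensorPow H N)
  | N + 2, k + 1 => (α_ H H (tensorPow H N)).inv ≫ ((β_ H H).hom ⊗ₘ braidPairs H N k) ≫
      (α_ H H (tensorPow H N)).hom
  | N, _ => 𝟙 (tensorPow H N)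

/-- `(1_{H^j}, ψ, …, ψ, 1, …, 1)` on `H^{⊗N}`, with `k` copies of the braiding `ψ`. -/
def braidRow (H : C) : (N j k : ℕ) → (tensorPow H N ⟶ tensorPow H N)
  | N, 0, k => braidPairs H N k
  | N + 1, j + 1, k => H ◁ braidRow H N j k
  | 0, _ + 1, _ => 𝟙 (tensorPow H 0)

/-- The composite of the rows `(1_{H^j}, ψ, …, ψ, 1_{H^j})` on `H^{⊗2n}`, with `n - j` copies of
`ψ`, over `1 ≤ j ≤ r`: the row `j = r` is applied first and the row `j = 1` last. -/
def braidProd (H : C) (n : ℕ) : (r : ℕ) → (tensorPow H (2 * n) ⟶ tensorPow H (2 * n))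
  | 0 => 𝟙 (tensorPow H (2 * n))
  | r + 1 => braidRow H (2 * n) (r + 1) (n - (r + 1)) ≫ braidProd H n r

/-- `𝓕_n(ψ) = ∏_{j=1}^{n-1} (1_{H^j}, ψ, …, ψ, 1_{H^j})`, with `n - j` copies of `ψ` in the `j`-th
factor. -/
def shuffle (H : C) (n : ℕ) : tensorPow H (2 * n) ⟶ tensorPow H (2 * n) :=
  braidProd H n (n - 1)

end Braided

/-- `(m, …, m) : H^{⊗2n} ⟶ H^{⊗n}`. -/
def mulPairs (H : C) [MonObj H] : (n : ℕ) → (tensorPow H (2 * n) ⟶ tensorPow H n)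
  | 0 => 𝟙 (𝟙_ C)
  | n + 1 => (α_ H H (tensorPow H (2 * n))).inv ≫ (μ[H] ⊗ₘ mulPairs H n)

/-- `m_n = (m, …, m) 𝓕_n(ψ) : H^{⊗n} ⊗ H^{⊗n} ⟶ H^{⊗n}`. -/
def mulPow [BraidedCategory C] (H : C) [MonObj H] (n : ℕ) :
    tensorPow H n ⊗ tensorPow H n ⟶ tensorPow H n :=
  (concatIso H n n).hom ≫ eqToHom (congrArg (tensorPow H) (two_mul n).symm) ≫
    shuffle H n ≫ mulPairs H n

/-- The iterated comultiplication `Δ^n : H ⟶ H^{⊗(n+1)}`, where `Δ^0 = 1` and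
`Δ^{n+1} = (1 ⊗ Δ^n) Δ`. -/
def iterComul (H : C) [ComonObj H] : (n : ℕ) → (H ⟶ tensorPow H (n + 1))
  | 0 => (ρ_ H).inv
  | n + 1 => Δ[H] ≫ H ◁ iterComul H n

/-- `(1, …, 1, Δ, 1, …, 1)`, with `Δ` on the tensor factor of (zero-based) index `i`. -/
def comulAt (H : C) [ComonObj H] : (n : ℕ) → Fin n → (tensorPow H n ⟶ tensorPow H (n + 1))
  | 0, i => i.elim0
  | n + 1, i => Fin.cases (motive := fun _ => tensorPow H (n + 1) ⟶ tensorPow H (n + 2))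
      (Δ[H] ▷ tensorPow H n ≫ (α_ H H (tensorPow H n)).hom) (fun k => H ◁ comulAt H n k) i

/-- `(1, …, 1, ε, 1, …, 1)`, with `ε` on the tensor factor of (zero-based) index `i`. -/
def counitAt (H : C) [ComonObj H] :
    (n : ℕ) → Fin (n + 1) → (tensorPow H (n + 1) ⟶ tensorPow H n)
  | 0, _ => ε[H] ▷ tensorPow H 0 ≫ (λ_ (tensorPow H 0)).hom
  | n + 1, i => Fin.cases (motive := fun _ => tensorPow H (n + 2) ⟶ tensorPow H (n + 1))
      (ε[H] ▷ tensorPow H (n + 1) ≫ (λ_ (tensorPow H (n + 1))).hom)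
      (fun k => H ◁ counitAt H n k) i

/-- `(1, …, 1, σ) : H^{⊗n} ⟶ H^{⊗(n+1)}`. -/
def appendLast (H : C) (σ : 𝟙_ C ⟶ H) : (n : ℕ) → (tensorPow H n ⟶ tensorPow H (n + 1))
  | 0 => σ ≫ (ρ_ H).inv
  | n + 1 => H ◁ appendLast H σ n

/-- `(η, 1, …, 1) : H^{⊗n} ⟶ H^{⊗(n+1)}`. -/
def unitFirst (H : C) [MonObj H] (n : ℕ) : tensorPow H n ⟶ tensorPow H (n + 1) :=
  (λ_ (tensorPow H n)).inv ≫ η[H] ▷ tensorPow H n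

variable [BraidedCategory C]

/-- The `δ`-twisted antipode `S̃ = (δ ⊗ S) Δ`. -/
def twistedAntipode (H : C) [HopfObj H] (δ : H ⟶ 𝟙_ C) : H ⟶ H :=
  Δ[H] ≫ (δ ⊗ₘ 𝒮[H]) ≫ (λ_ H).hom

/-- A character of `H`: an algebra map `δ : H ⟶ I`. -/
structure IsCharacter (H : C) [HopfObj H] (δ : H ⟶ 𝟙_ C) : Prop where
  mul : μ[H] ≫ δ = (δ ⊗ₘ δ) ≫ (λ_ (𝟙_ C)).hom
  one : η[H] ≫ δ = 𝟙 (𝟙_ C)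

/-- A co-character of `H`: a coalgebra map `σ : I ⟶ H`. -/
structure IsCocharacter (H : C) [HopfObj H] (σ : 𝟙_ C ⟶ H) : Prop where
  comul : σ ≫ Δ[H] = (λ_ (𝟙_ C)).inv ≫ (σ ⊗ₘ σ)
  counit : σ ≫ ε[H] = 𝟙 (𝟙_ C)

/-- A braided modular pair in involution `(δ, σ)`: a character and a co-character with `δ σ = 1_I`
and `m (m ⊗ 1) (S σ ⊗ S̃² ⊗ σ) = 1_H`. -/
structure IsModularPairInInvolution (H : C) [HopfObj H] (δ : H ⟶ 𝟙_ C) (σ : 𝟙_ C ⟶ H) :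
    Prop where
  character : IsCharacter H δ
  cocharacter : IsCocharacter H σ
  modular : σ ≫ δ = 𝟙 (𝟙_ C)
  involution :
    (λ_ H).inv ≫ (ρ_ (𝟙_ C ⊗ H)).inv ≫
      (((σ ≫ 𝒮[H]) ⊗ₘ (twistedAntipode H δ ≫ twistedAntipode H δ)) ⊗ₘ σ) ≫
        μ[H] ▷ H ≫ μ[H] = 𝟙 H

/-- The cofaces `δ_i : H^{⊗n} ⟶ H^{⊗(n+1)}`, `0 ≤ i ≤ n + 1`: `(η, 1, …, 1)` for `i = 0`,
`Δ` on the `i`-th factor for `1 ≤ i ≤ n`, and `(1, …, 1, σ)` for `i = n + 1`. -/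
def coface (H : C) [HopfObj H] (σ : 𝟙_ C ⟶ H) (n : ℕ) (i : Fin (n + 2)) :
    tensorPow H n ⟶ tensorPow H (n + 1) :=
  Fin.cases (motive := fun _ => tensorPow H n ⟶ tensorPow H (n + 1)) (unitFirst H n)
    (fun k => Fin.lastCases (motive := fun _ => tensorPow H n ⟶ tensorPow H (n + 1))
      (appendLast H σ n) (fun l => comulAt H n l) k) i

/-- The codegeneracies `σ_i : H^{⊗(n+1)} ⟶ H^{⊗n}`, `0 ≤ i ≤ n`: `ε` on the `(i+1)`-th factor. -/
def codegeneracy (H : C) [HopfObj H] (n : ℕ) (i : Fin (n + 1)) :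
    tensorPow H (n + 1) ⟶ tensorPow H n :=
  counitAt H n i

/-- The cyclic operators: `τ_0 = 1_I` and `τ_n = m_n (Δ^{n-1} S̃, 1_{H^{n-1}}, σ)` for `n ≥ 1`. -/
def cyclicOp (H : C) [HopfObj H] (δ : H ⟶ 𝟙_ C) (σ : 𝟙_ C ⟶ H) :
    (n : ℕ) → (tensorPow H n ⟶ tensorPow H n)
  | 0 => 𝟙 (𝟙_ C)
  | n + 1 => ((twistedAntipode H δ ≫ iterComul H n) ⊗ₘ appendLast H σ n) ≫ mulPow H (n + 1)

end BraidedHopf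

/-! The shuffled product `mulPow` is the multiplication of `H^n` as an iterated braided tensor
product of algebras (`mulPow_succ`, `mulPow_eq_mul`). Hence `τ_{n+1}` sends `h ⊗ x` to the product
of `Δ^n S̃ h` and `x ⊗ σ` in an algebra. Comultiplications and counits on single factors are algebra
maps, so they pass through this product. This reduces most identities for `τ` to cosimplicial ones
and to coassociativity, and `τ δ_0` only needs `S̃ η = η`.

Two identities rest on antipode cancellations. For `τ δ_1 = δ_0 τ`, the antipode reverses `Δ` up to
a braiding, so the first factor collects `S(h₂) h₃`, which collapses to `η` (`comulHead_comp_mul`).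
For `τ σ_0 = σ_n τ²` in positive degree, `σ_n τ` is left multiplication by an iterated coproduct of
`S̃`; as `S̃` reverses products, `S̃(h₁) h₂ = δ(h)` applies, and `δ S̃ = ε` finishes
(`twistedAntipode_comul_tensor_comp_mul`). In both, the hexagon merges the crossings into one and
naturality slides the cancellation through it, so symmetry of the braiding is not needed. -/

namespace BraidedHopf

variable {C : Type u} [Category.{v} C] [MonoidalCategory C]

/-- `1_H ⊗ f` as a morphism between tensor powers. -/
def consMap (H : C) {m n : ℕ} (f : tensorPow H m ⟶ tensorPow H n) :
    tensorPow H (m + 1) ⟶ tensorPow H (n + 1) :=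
  H ◁ f

lemma consMap_id (H : C) (n : ℕ) : consMap H (𝟙 (tensorPow H n)) = 𝟙 (tensorPow H (n + 1)) :=
  whiskerLeft_id _ _

lemma consMap_comp (H : C) {l m n : ℕ} (f : tensorPow H l ⟶ tensorPow H m)
    (g : tensorPow H m ⟶ tensorPow H n) : consMap H (f ≫ g) = consMap H f ≫ consMap H g :=
  whiskerLeft_comp _ _ _

lemma consMap_comp_assoc (H : C) {l m n : ℕ} (f : tensorPow H l ⟶ tensorPow H m)
    (g : tensorPow H m ⟶ tensorPow H n) {Z : C} (h : tensorPow H (n + 1) ⟶ Z) :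
    consMap H (f ≫ g) ≫ h = consMap H f ≫ consMap H g ≫ h := by
  rw [consMap_comp, Category.assoc]

/-- The comparison of the tensor powers of equal exponents. -/
def castMap (H : C) {m n : ℕ} (h : m = n) : tensorPow H m ⟶ tensorPow H n :=
  eqToHom (congrArg (tensorPow H) h)

lemma consMap_castMap (H : C) {m n : ℕ} (h : m = n) (h' : m + 1 = n + 1) :
    consMap H (castMap H h) = castMap H h' := by
  subst h
  exact consMap_id H m

variable [BraidedCategory C]

/-! ### The shuffle as an iterated tensor strength -/

/-- The composite of adjacent braidings that carries the factor of (zero-based) index `a` of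
`H^{⊗N}` to the front. -/
def braidToFront (H : C) : (N a : ℕ) → (tensorPow H N ⟶ tensorPow H N)
  | N + 1, a + 1 => consMap H (braidToFront H N a) ≫ braidPairs H (N + 1) 1
  | N, _ => 𝟙 (tensorPow H N)

/-- The composite of the rows `(1_{H^j}, ψ, …, ψ, 1, …, 1)` on `H^{⊗N}`, with `n - j` copies of
`ψ`, over `1 ≤ j ≤ r`; the row `j = r` is applied first. -/
def rowProd (H : C) (N n : ℕ) : (r : ℕ) → (tensorPow H N ⟶ tensorPow H N)
  | 0 => 𝟙 (tensorPow H N)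
  | r + 1 => braidRow H N (r + 1) (n - (r + 1)) ≫ rowProd H N n r

/-- The shuffle recursion compares rows on `2n + 2` factors with rows on `2n`. Decoupling the number
of factors from `n` permits induction on the number of rows alone. -/
lemma braidProd_eq_rowProd (H : C) (n r : ℕ) : braidProd H n r = rowProd H (2 * n) n r := by
  induction r with
  | zero => rfl
  | succ r ih => exact congrArg (_ ≫ ·) ih

lemma braidPairs_zero (H : C) (N : ℕ) : braidPairs H N 0 = 𝟙 (tensorPow H N) := by
  rcases N with _ | _ | N <;> rfl

lemma whiskerLeft_whiskerLeft_comp_braiding (H : C) {X Y : C} (f : X ⟶ Y) :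
    (H ◁ H ◁ f) ≫ (α_ H H Y).inv ≫ (β_ H H).hom ▷ Y ≫ (α_ H H Y).hom =
      ((α_ H H X).inv ≫ (β_ H H).hom ▷ X ≫ (α_ H H X).hom) ≫ H ◁ H ◁ f := by
  have h := whisker_exchange (β_ H H).hom f
  calc _ = (α_ H H X).inv ≫ ((H ⊗ H) ◁ f ≫ (β_ H H).hom ▷ Y) ≫ (α_ H H Y).hom := by monoidal
    _ = _ := by rw [h]; monoidal

lemma braidPairs_one (H : C) (N : ℕ) : braidPairs H (N + 2) 1 =
    (α_ H H (tensorPow H N)).inv ≫ (β_ H H).hom ▷ tensorPow H N ≫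
      (α_ H H (tensorPow H N)).hom := by
  rw [← tensorHom_id, ← braidPairs_zero]; rfl

lemma consMap_consMap_comp_braidPairs_one (H : C) {N : ℕ}
    (f : tensorPow H N ⟶ tensorPow H N) :
    consMap H (consMap H f) ≫ braidPairs H (N + 2) 1 =
      braidPairs H (N + 2) 1 ≫ consMap H (consMap H f) := by
  rw [braidPairs_one]
  exact whiskerLeft_whiskerLeft_comp_braiding H f

lemma braidPairs_succ_eq (H : C) (N k : ℕ) : braidPairs H (N + 2) (k + 1) =
    braidPairs H (N + 2) 1 ≫ consMap H (consMap H (braidPairs H N k)) := by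
  rw [braidPairs_one]
  -- Coherence is run on an arbitrary object, and `exact` then identifies the tensor powers by
  -- unfolding. The same device recurs below as `key`.
  have : ∀ {X : C} (f : X ⟶ X), (α_ H H X).inv ≫ ((β_ H H).hom ⊗ₘ f) ≫ (α_ H H X).hom =
      ((α_ H H X).inv ≫ (β_ H H).hom ▷ X ≫ (α_ H H X).hom) ≫ H ◁ H ◁ f := by
    intro X f
    rw [MonoidalCategory.tensorHom_def]; monoidal
  exact this _

lemma braidRow_succ (H : C) (N j k : ℕ) :
    braidRow H (N + 1) (j + 1) k = consMap H (braidRow H N j k) := rfl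

lemma braidRow_zero (H : C) (N k : ℕ) : braidRow H N 0 k = braidPairs H N k := by
  cases N <;> rfl

lemma braidRow_zero_right (H : C) (N j : ℕ) : braidRow H N j 0 = 𝟙 (tensorPow H N) := by
  induction j generalizing N with
  | zero => rw [braidRow_zero, braidPairs_zero]
  | succ j ih =>
    cases N with
    | zero => rfl
    | succ N => rw [braidRow_succ, ih, consMap_id]

lemma braidRow_of_le_one (H : C) (N : ℕ) (hN : N ≤ 1) (j k : ℕ) :
    braidRow H N j k = 𝟙 (tensorPow H N) := by
  induction j generalizing N with
  | zero => rw [braidRow_zero]; rcases N with _ | _ | N <;> first | rfl | omega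
  | succ j ih =>
    cases N with
    | zero => rfl
    | succ N => rw [braidRow_succ, ih _ (by omega), consMap_id]

/-- The leftmost braiding of a row occupies two places, so the rest of the row begins at offset `r +
2`. -/
lemma braidRow_succ_right (H : C) (N r k : ℕ) :
    braidRow H (N + 2) r (k + 1) = braidRow H (N + 2) r 1 ≫ braidRow H (N + 2) (r + 2) k := by
  induction r generalizing N with
  | zero => rw [braidRow_zero, braidRow_zero, braidPairs_succ_eq, braidRow_succ, braidRow_succ,
      braidRow_zero]
  | succ r ih =>
    rw [braidRow_succ, braidRow_succ H _ r 1, braidRow_succ H _ (r + 2), ← consMap_comp]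
    cases N with
    | zero => simp only [braidRow_of_le_one H (0 + 1) le_rfl, Category.comp_id]
    | succ N => rw [ih]

lemma braidToFront_zero (H : C) (N : ℕ) : braidToFront H N 0 = 𝟙 (tensorPow H N) := by
  cases N <;> rfl

lemma braidToFront_succ (H : C) (N a : ℕ) : braidToFront H (N + 1) (a + 1) =
    consMap H (braidToFront H N a) ≫ braidPairs H (N + 1) 1 := rfl

/-- The definition splits off the braiding applied last; here the one applied first is split off, to
match the order of the rows in `rowProd`. -/
lemma braidToFront_succ_eq (H : C) (N a : ℕ) :
    braidToFront H N (a + 1) = braidRow H N a 1 ≫ braidToFront H N a := by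
  induction a generalizing N with
  | zero =>
    rw [braidToFront_zero, Category.comp_id, braidRow_zero]
    cases N with
    | zero => rfl
    | succ N => rw [braidToFront_succ, braidToFront_zero, consMap_id, Category.id_comp]
  | succ a ih =>
    cases N with
    | zero => exact (Category.comp_id _).symm
    | succ N =>
      rw [braidToFront_succ, ih, braidRow_succ, braidToFront_succ H N a, consMap_comp,
        Category.assoc]

/-- The supports are disjoint: one map touches indices up to `r`, the other only indices from `j >
r` on. -/
lemma braidRow_comp_braidToFront (H : C) (N r j k : ℕ) (hj : r < j) :
    braidRow H N j k ≫ braidToFront H N r = braidToFront H N r ≫ braidRow H N j k := by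
  induction r generalizing N j with
  | zero => rw [braidToFront_zero, Category.comp_id, Category.id_comp]
  | succ r ih =>
    obtain ⟨j, rfl⟩ : ∃ i, j = i + 2 := ⟨j - 2, by omega⟩
    cases N with
    | zero => rfl
    | succ N =>
      have h : consMap H (braidRow H N (j + 1) k) ≫ braidPairs H (N + 1) 1 =
          braidPairs H (N + 1) 1 ≫ consMap H (braidRow H N (j + 1) k) := by
        cases N with
        | zero => exact (Category.comp_id _).trans (Category.id_comp _).symm
        | succ N => exact consMap_consMap_comp_braidPairs_one H _
      rw [braidRow_succ, braidToFront_succ, Category.assoc, ← h, ← Category.assoc,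
        ← Category.assoc, ← consMap_comp, ← consMap_comp, ih _ _ (by omega)]

/-- Cut the leftmost braiding off every row. The remainders are the rows for `n` shifted by two
places, and they commute past the cut braidings of the later rows. The cut braidings together carry
the factor of index `r + 1` to index `1`. -/
lemma rowProd_succ_eq (H : C) (N n r : ℕ) (hr : r ≤ n) :
    rowProd H (N + 2) (n + 1) r =
      consMap H (braidToFront H (N + 1) r) ≫ consMap H (consMap H (rowProd H N n r)) := by
  induction r with
  | zero => rw [braidToFront_zero, rowProd, rowProd, consMap_id, consMap_id, consMap_id,
      Category.comp_id]
  | succ r ih =>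
    obtain ⟨k, rfl⟩ := Nat.exists_eq_add_of_lt hr
    have h1 : r + k + 1 + 1 - (r + 1) = k + 1 := by omega
    have h2 : r + k + 1 - (r + 1) = k := by omega
    have h3 := braidRow_comp_braidToFront H (N + 1) r (r + 2) k (by omega)
    rw [rowProd, rowProd, h1, h2, ih (by omega), braidRow_succ_right, braidToFront_succ_eq,
      braidRow_succ H (N + 1), braidRow_succ H (N + 1)]
    simp only [consMap_comp, Category.assoc]
    rw [← consMap_comp_assoc H (braidRow H (N + 1) (r + 2) k), h3, consMap_comp_assoc,
      braidRow_succ H N]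

/-- The row `j = n` contains no braiding, so the product may stop at `n` or at `n - 1`. -/
lemma rowProd_succ_self (H : C) (N n : ℕ) : rowProd H N n n = rowProd H N n (n - 1) := by
  cases n with
  | zero => rfl
  | succ n => rw [rowProd, Nat.sub_self, braidRow_zero_right, Category.id_comp]; rfl

lemma braiding_tensor_left_comp (H : C) {X Y Z : C} (c : X ⊗ Y ⟶ Z) :
    (α_ H X (H ⊗ Y)).hom ≫
      (H ◁ ((α_ X H Y).inv ≫ (β_ X H).hom ▷ Y ≫ (α_ H X Y).hom ≫ H ◁ c)) ≫
        ((α_ H H Z).inv ≫ (β_ H H).hom ▷ Z ≫ (α_ H H Z).hom) =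
      (α_ (H ⊗ X) H Y).inv ≫ (β_ (H ⊗ X) H).hom ▷ Y ≫ (α_ H (H ⊗ X) Y).hom ≫
        H ◁ ((α_ H X Y).hom ≫ H ◁ c) := by
  have h := whiskerLeft_whiskerLeft_comp_braiding H c
  simp only [whiskerLeft_comp, Category.assoc] at h ⊢
  rw [h, BraidedCategory.braiding_tensor_left_hom]
  monoidal

/-- By the hexagon, the adjacent braidings that carry one factor across `a` others compose to the
braiding with the whole block `H^a`. The exponents agree only propositionally, whence `N` and the
comparison maps. -/
lemma concatIso_comp_braidToFront (H : C) (a b N : ℕ) (h : b + a = N) (h' : b + 1 + a = N + 1) :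
    (concatIso H (b + 1) a).hom ≫ castMap H h' ≫ braidToFront H (N + 1) a =
      (α_ (tensorPow H a) H (tensorPow H b)).inv ≫ (β_ (tensorPow H a) H).hom ▷ tensorPow H b ≫
        (α_ H (tensorPow H a) (tensorPow H b)).hom ≫
          H ◁ ((concatIso H b a).hom ≫ castMap H h) := by
  induction a generalizing N with
  | zero =>
    subst h
    have e : castMap H h' = 𝟙 _ := rfl
    have e' : castMap H (rfl : b + 0 = b + 0) = 𝟙 _ := rfl
    rw [braidToFront_zero, e, Category.comp_id, Category.comp_id, e', Category.comp_id]
    have key : ∀ Y : C, (λ_ (H ⊗ Y)).hom = (α_ (𝟙_ C) H Y).inv ≫ (β_ (𝟙_ C) H).hom ▷ Y ≫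
        (α_ H (𝟙_ C) Y).hom ≫ H ◁ (λ_ Y).hom := by
      intro Y
      rw [braiding_tensorUnit_left]
      monoidal
    exact key _
  | succ a ih =>
    subst h
    have ih' := ih (b + a) rfl (by omega)
    rw [braidToFront_succ, ← consMap_castMap H (m := b + 1 + a) (n := b + a + 1) (by omega)]
    have e : castMap H (rfl : b + (a + 1) = b + (a + 1)) = 𝟙 _ := rfl
    have e' : castMap H (rfl : b + a = b + a) = 𝟙 _ := rfl
    rw [e', Category.comp_id] at ih'
    rw [e, Category.comp_id]
    have key := braiding_tensor_left_comp H (concatIso H b a).hom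
    rw [← ih', ← braidPairs_one] at key
    refine Eq.trans ?_ key
    have assoc : ∀ {P Q R S T : C} (x : P ⟶ H ⊗ Q) (c : Q ⟶ R) (d : R ⟶ S) (e : H ⊗ S ⟶ T),
        (x ≫ H ◁ c) ≫ H ◁ d ≫ e = x ≫ H ◁ (c ≫ d) ≫ e := by
      intros; simp
    rw [← consMap_comp_assoc]
    exact assoc _ _ _ _

lemma shuffle_succ (H : C) (n : ℕ) : shuffle H (n + 1) =
    consMap H (braidToFront H (2 * n + 1) n) ≫ consMap H (consMap H (shuffle H n)) := by
  unfold shuffle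
  rw [braidProd_eq_rowProd, braidProd_eq_rowProd, ← rowProd_succ_self H _ n]
  exact rowProd_succ_eq H (2 * n) n n le_rfl

/-- This is the recursion defining the product of the algebra `H ⊗ H^n`: the block braiding from
`concatIso_comp_braidToFront` is the crossing inside `tensorμ`. -/
lemma mulPow_succ (H : C) [MonObj H] (n : ℕ) : mulPow H (n + 1) =
    tensorμ H (tensorPow H n) H (tensorPow H n) ≫ (μ[H] ⊗ₘ mulPow H n) := by
  have key : ∀ {X Y Z Z' W W' V : C} {k : X ⊗ (H ⊗ Y) ⟶ Z} {t : Z ⟶ Z'} {l : Z' ⟶ H ⊗ W}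
      {c : X ⊗ Y ⟶ W'} {t' : W' ⟶ W} (f : W ⟶ V) (g : V ⟶ Y),
      k ≫ t ≫ l = (α_ X H Y).inv ≫ (β_ X H).hom ▷ Y ≫ (α_ H X Y).hom ≫ H ◁ (c ≫ t') →
      ((α_ H X (H ⊗ Y)).hom ≫ H ◁ k) ≫ H ◁ t ≫ (H ◁ l ≫ H ◁ H ◁ f) ≫
          (α_ H H V).inv ≫ (μ[H] ⊗ₘ g) = tensorμ H X H Y ≫ (μ[H] ⊗ₘ (c ≫ t' ≫ f ≫ g)) := by
    intro X Y Z Z' W W' V k t l c t' f g h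
    calc _ = (α_ H X (H ⊗ Y)).hom ≫ (H ◁ (k ≫ t ≫ l)) ≫ (H ◁ H ◁ f) ≫
          (α_ H H V).inv ≫ (μ[H] ⊗ₘ g) := by simp
      _ = _ := by
        rw [h, tensorμ]
        simp only [MonoidalCategory.tensorHom_def']
        monoidal
  have := key (shuffle H n) (mulPairs H n)
    (concatIso_comp_braidToFront H n n (2 * n) (two_mul n).symm (by omega))
  refine Eq.trans ?_ this
  unfold mulPow
  rw [shuffle_succ]
  have e : eqToHom (congrArg (tensorPow H) (two_mul (n + 1)).symm) =
    consMap H (castMap H (by omega : n + 1 + n = 2 * n + 1)) :=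
    (consMap_castMap H (m := n + 1 + n) (n := 2 * n + 1) (by omega) (by omega)).symm
  rw [e]
  rfl

end BraidedHopf

namespace BraidedHopf

variable {C : Type u} [Category.{v} C] [MonoidalCategory C]

/-! ### The cosimplicial identities -/

lemma comp_unitFirst (H : C) [MonObj H] {m n : ℕ} (f : tensorPow H m ⟶ tensorPow H n) :
    f ≫ unitFirst H n = unitFirst H m ≫ consMap H f := by
  have key : ∀ {X Y : C} (f : X ⟶ Y), f ≫ (λ_ Y).inv ≫ η[H] ▷ Y =
      ((λ_ X).inv ≫ η[H] ▷ X) ≫ H ◁ f := by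
    intro X Y f
    rw [leftUnitor_inv_naturality_assoc, whisker_exchange, Category.assoc]
  exact key f

lemma counitAt_succ (H : C) [ComonObj H] (n : ℕ) (k : Fin (n + 1)) :
    counitAt H (n + 1) k.succ = consMap H (counitAt H n k) := rfl

lemma counitAt_zero (H : C) [ComonObj H] (n : ℕ) :
    counitAt H n 0 = ε[H] ▷ tensorPow H n ≫ (λ_ (tensorPow H n)).hom := by
  cases n <;> rfl

lemma consMap_comp_comulAt_zero (H : C) [ComonObj H] {m n : ℕ}
    (f : tensorPow H m ⟶ tensorPow H n) :
    consMap H f ≫ comulAt H (n + 1) 0 = comulAt H (m + 1) 0 ≫ consMap H (consMap H f) := by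
  have key : ∀ {X Y : C} (f : X ⟶ Y), H ◁ f ≫ Δ[H] ▷ Y ≫ (α_ H H Y).hom =
      (Δ[H] ▷ X ≫ (α_ H H X).hom) ≫ H ◁ H ◁ f := by
    intro X Y f
    rw [whisker_exchange_assoc]; simp
  exact key f

lemma consMap_comp_counitAt_zero (H : C) [ComonObj H] {m n : ℕ}
    (f : tensorPow H m ⟶ tensorPow H n) :
    consMap H f ≫ counitAt H n 0 = counitAt H m 0 ≫ f := by
  have key : ∀ {X Y : C} (f : X ⟶ Y), H ◁ f ≫ ε[H] ▷ Y ≫ (λ_ Y).hom =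
      (ε[H] ▷ X ≫ (λ_ X).hom) ≫ f := by
    intro X Y f
    rw [whisker_exchange_assoc]; simp
  rw [counitAt_zero, counitAt_zero]
  exact key f

lemma comulAt_zero_comp_comulAt_one (H : C) [ComonObj H] (n : ℕ) :
    comulAt H (n + 1) 0 ≫ consMap H (comulAt H (n + 1) 0) =
      comulAt H (n + 1) 0 ≫ comulAt H (n + 2) 0 := by
  have key : ∀ X : C, (Δ[H] ▷ X ≫ (α_ H H X).hom) ≫ H ◁ (Δ[H] ▷ X ≫ (α_ H H X).hom) =
      (Δ[H] ▷ X ≫ (α_ H H X).hom) ≫ Δ[H] ▷ (H ⊗ X) ≫ (α_ H H (H ⊗ X)).hom := by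
    intro X
    have h := congrArg (fun k => k ▷ X ≫ (α_ H (H ⊗ H) X).hom ≫ H ◁ (α_ H H X).hom)
      (ComonObj.comul_assoc H)
    simp only [comp_whiskerRight] at h
    calc _ = (Δ[H] ▷ X ≫ (H ◁ Δ[H]) ▷ X) ≫ (α_ H (H ⊗ H) X).hom ≫ H ◁ (α_ H H X).hom := by
          monoidal
      _ = _ := by rw [h]; monoidal
  exact key _

lemma comulAt_zero_comp_counitAt_zero (H : C) [ComonObj H] (n : ℕ) :
    comulAt H (n + 1) 0 ≫ counitAt H (n + 1) 0 = 𝟙 (tensorPow H (n + 1)) := by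
  have key : ∀ X : C, (Δ[H] ▷ X ≫ (α_ H H X).hom) ≫ ε[H] ▷ (H ⊗ X) ≫ (λ_ (H ⊗ X)).hom =
      𝟙 (H ⊗ X) := by
    intro X
    calc _ = (Δ[H] ≫ ε[H] ▷ H) ▷ X ≫ (λ_ H).hom ▷ X := by monoidal
      _ = _ := by rw [ComonObj.counit_comul]; monoidal
  exact key _

lemma comulAt_zero_comp_counitAt_one (H : C) [ComonObj H] (n : ℕ) :
    comulAt H (n + 1) 0 ≫ consMap H (counitAt H n 0) = 𝟙 (tensorPow H (n + 1)) := by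
  have key : ∀ X : C, (Δ[H] ▷ X ≫ (α_ H H X).hom) ≫ H ◁ (ε[H] ▷ X ≫ (λ_ X).hom) =
      𝟙 (H ⊗ X) := by
    intro X
    calc _ = (Δ[H] ≫ H ◁ ε[H]) ▷ X ≫ (ρ_ H).hom ▷ X := by monoidal
      _ = _ := by rw [ComonObj.comul_counit]; monoidal
  rw [counitAt_zero]
  exact key _

lemma counitAt_comp_counitAt (H : C) [ComonObj H] (n : ℕ) (i j : Fin (n + 1)) (hij : i ≤ j) :
    counitAt H (n + 1) i.castSucc ≫ counitAt H n j =
      counitAt H (n + 1) j.succ ≫ counitAt H n i := by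
  induction n with
  | zero =>
    obtain rfl := Fin.fin_one_eq_zero i
    exact (consMap_comp_counitAt_zero H _).symm
  | succ n ih =>
    cases i using Fin.cases with
    | zero => exact (consMap_comp_counitAt_zero H _).symm
    | succ i =>
      cases j using Fin.cases with
      | zero => simp at hij
      | succ j =>
        rw [Fin.succ_le_succ_iff] at hij
        rw [← Fin.succ_castSucc, counitAt_succ H (n + 1), counitAt_succ H n j,
          ← consMap_comp, ih _ _ hij, consMap_comp, counitAt_succ H (n + 1), counitAt_succ H n i]

variable [BraidedCategory C]

lemma unitFirst_comp_comulAt_zero (H : C) [BimonObj H] (n : ℕ) :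
    unitFirst H n ≫ comulAt H (n + 1) 0 = unitFirst H n ≫ unitFirst H (n + 1) := by
  have key : ∀ X : C, ((λ_ X).inv ≫ η[H] ▷ X) ≫ Δ[H] ▷ X ≫ (α_ H H X).hom =
      ((λ_ X).inv ≫ η[H] ▷ X) ≫ (λ_ (H ⊗ X)).inv ≫ η[H] ▷ (H ⊗ X) := by
    intro X
    have h := congrArg (fun k => (λ_ X).inv ≫ k ▷ X ≫ (α_ H H X).hom) (Bimon.one_comul H)
    simp only [comp_whiskerRight, MonoidalCategory.tensorHom_def'] at h
    calc _ = (λ_ X).inv ≫ (η[H] ▷ X ≫ Δ[H] ▷ X) ≫ (α_ H H X).hom := by monoidal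
      _ = _ := by rw [h]; monoidal
  exact key _

lemma unitFirst_comp_counitAt_zero (H : C) [BimonObj H] (n : ℕ) :
    unitFirst H n ≫ counitAt H n 0 = 𝟙 (tensorPow H n) := by
  have key : ∀ X : C, ((λ_ X).inv ≫ η[H] ▷ X) ≫ ε[H] ▷ X ≫ (λ_ X).hom = 𝟙 X := by
    intro X
    calc _ = (λ_ X).inv ≫ (η[H] ≫ ε[H]) ▷ X ≫ (λ_ X).hom := by monoidal
      _ = _ := by rw [BimonObj.one_counit]; monoidal
  rw [counitAt_zero]
  exact key _

section Coface

variable (H : C) [HopfObj H] (σ : 𝟙_ C ⟶ H)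

lemma coface_zero (n : ℕ) : coface H σ n 0 = unitFirst H n := rfl

lemma coface_last (n : ℕ) : coface H σ n (Fin.last (n + 1)) = appendLast H σ n := by
  rw [← Fin.succ_last, coface, Fin.cases_succ, Fin.lastCases_last]

lemma coface_castSucc_succ (n : ℕ) (l : Fin n) :
    coface H σ n l.castSucc.succ = comulAt H n l := by
  simp [coface]

lemma coface_succ_zero (n : ℕ) :
    coface H σ (n + 1) (Fin.succ 0) = comulAt H (n + 1) 0 :=
  coface_castSucc_succ H σ (n + 1) 0

/-- This drives the inductions on `n`: stripping the first factor leaves only cases with the unit or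
`Δ` on that factor, and `σ` has to be treated by hand only in degree `0`. -/
lemma coface_succ_succ (n : ℕ) (k : Fin (n + 1)) :
    coface H σ (n + 1) k.succ.succ = consMap H (coface H σ n k.succ) := by
  cases k using Fin.lastCases with
  | last =>
    rw [Fin.succ_last, Fin.succ_last, coface_last, coface_last]; rfl
  | cast l =>
    rw [coface_castSucc_succ, Fin.succ_castSucc, coface_castSucc_succ]; rfl

variable {σ}

lemma IsCocharacter.appendLast_comp_coface_last (hσ : IsCocharacter H σ) :
    appendLast H σ 0 ≫ consMap H (appendLast H σ 0) =
      appendLast H σ 0 ≫ comulAt H 1 0 := by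
  have key : (σ ≫ (ρ_ H).inv) ≫ H ◁ (σ ≫ (ρ_ H).inv) =
      (σ ≫ (ρ_ H).inv) ≫ Δ[H] ▷ (𝟙_ C) ≫ (α_ H H (𝟙_ C)).hom := by
    calc _ = ((λ_ (𝟙_ C)).inv ≫ σ ▷ (𝟙_ C) ≫ H ◁ σ) ≫ H ◁ (ρ_ H).inv := by monoidal
      _ = (σ ≫ Δ[H]) ≫ H ◁ (ρ_ H).inv := by
        rw [← MonoidalCategory.tensorHom_def, hσ.comul]
      _ = _ := by monoidal
  exact key

lemma IsCocharacter.coface_comp_coface (hσ : IsCocharacter H σ) (n : ℕ) (i j : Fin (n + 2))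
    (hij : i ≤ j) : coface H σ n i ≫ coface H σ (n + 1) j.succ =
      coface H σ n j ≫ coface H σ (n + 1) i.castSucc := by
  induction n with
  | zero =>
    cases i using Fin.cases with
    | zero =>
      cases j using Fin.cases with
      | zero => exact unitFirst_comp_comulAt_zero H 0
      | succ j => rw [coface_succ_succ]; exact (comp_unitFirst H _).symm
    | succ i =>
      cases j using Fin.cases with
      | zero => simp at hij
      | succ j =>
        obtain rfl := Fin.fin_one_eq_zero i
        obtain rfl := Fin.fin_one_eq_zero j
        exact hσ.appendLast_comp_coface_last
  | succ n ih =>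
    cases i using Fin.cases with
    | zero =>
      cases j using Fin.cases with
      | zero => rw [coface_succ_zero, Fin.castSucc_zero, coface_zero, coface_zero,
          unitFirst_comp_comulAt_zero]
      | succ j => rw [coface_succ_succ]; exact (comp_unitFirst H _).symm
    | succ i =>
      cases j using Fin.cases with
      | zero => simp at hij
      | succ j =>
        rw [Fin.succ_le_succ_iff] at hij
        rw [coface_succ_succ, ← Fin.succ_castSucc]
        cases i using Fin.cases with
        | zero =>
          rw [Fin.castSucc_zero, coface_succ_zero, coface_succ_zero]
          cases j using Fin.cases with
          | zero => rw [coface_succ_zero, comulAt_zero_comp_comulAt_one]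
          | succ j =>
            rw [coface_succ_succ, consMap_comp_comulAt_zero]
        | succ i =>
          cases j using Fin.cases with
          | zero => simp at hij
          | succ j =>
            have h := ih i.succ j.succ hij
            rw [coface_succ_succ] at h
            rw [coface_succ_succ, coface_succ_succ, ← Fin.succ_castSucc, coface_succ_succ,
              ← consMap_comp, ← consMap_comp, h, Fin.succ_castSucc]

lemma coface_comp_counitAt_of_le (n : ℕ) (i : Fin (n + 2)) (j : Fin (n + 1))
    (hij : i ≤ j.castSucc) : coface H σ (n + 1) i.castSucc ≫ counitAt H (n + 1) j.succ =
      counitAt H n j ≫ coface H σ n i := by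
  induction n with
  | zero =>
    obtain rfl := Fin.fin_one_eq_zero j
    obtain rfl : i = 0 := by simpa using hij
    rw [counitAt_succ]; exact (comp_unitFirst H _).symm
  | succ n ih =>
    cases i using Fin.cases with
    | zero => rw [counitAt_succ]; exact (comp_unitFirst H _).symm
    | succ i =>
      cases j using Fin.cases with
      | zero => simp at hij
      | succ j =>
        rw [← Fin.succ_castSucc, Fin.succ_le_succ_iff] at hij
        rw [← Fin.succ_castSucc]
        cases i using Fin.cases with
        | zero =>
          rw [Fin.castSucc_zero, coface_succ_zero, coface_succ_zero, counitAt_succ, counitAt_succ,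
            consMap_comp_comulAt_zero]
        | succ i =>
          have h := ih i.succ j hij
          rw [← Fin.succ_castSucc] at h ⊢
          rw [coface_succ_succ, coface_succ_succ, counitAt_succ, counitAt_succ, ← consMap_comp,
            ← consMap_comp, ← h, counitAt_succ]

lemma coface_castSucc_comp_counitAt (n : ℕ) (i : Fin (n + 1)) :
    coface H σ n i.castSucc ≫ counitAt H n i = 𝟙 (tensorPow H n) := by
  induction n with
  | zero =>
    obtain rfl := Fin.fin_one_eq_zero i
    exact unitFirst_comp_counitAt_zero H 0
  | succ n ih =>
    cases i using Fin.cases with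
    | zero => exact unitFirst_comp_counitAt_zero H (n + 1)
    | succ i =>
      rw [← Fin.succ_castSucc, counitAt_succ]
      cases i using Fin.cases with
      | zero => rw [Fin.castSucc_zero, coface_succ_zero, comulAt_zero_comp_counitAt_one]
      | succ i =>
        have h := ih i.succ
        rw [← Fin.succ_castSucc] at h ⊢
        rw [coface_succ_succ, ← consMap_comp, h, consMap_id]

lemma IsCocharacter.coface_succ_comp_counitAt (hσ : IsCocharacter H σ) (n : ℕ) (i : Fin (n + 1)) :
    coface H σ n i.succ ≫ counitAt H n i = 𝟙 (tensorPow H n) := by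
  induction n with
  | zero =>
    obtain rfl := Fin.fin_one_eq_zero i
    have key : (σ ≫ (ρ_ H).inv) ≫ ε[H] ▷ (𝟙_ C) ≫ (λ_ (𝟙_ C)).hom = 𝟙 (𝟙_ C) := by
      calc _ = σ ≫ ε[H] := by monoidal
        _ = _ := hσ.counit
    exact key
  | succ n ih =>
    cases i using Fin.cases with
    | zero => rw [coface_succ_zero, comulAt_zero_comp_counitAt_zero]
    | succ i => rw [coface_succ_succ, counitAt_succ, ← consMap_comp, ih, consMap_id]

lemma coface_comp_counitAt_of_gt (n : ℕ) (i : Fin (n + 2)) (j : Fin (n + 1))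
    (hij : j.castSucc < i) : coface H σ (n + 1) i.succ ≫ counitAt H (n + 1) j.castSucc =
      counitAt H n j ≫ coface H σ n i := by
  induction n with
  | zero =>
    obtain rfl := Fin.fin_one_eq_zero j
    cases i using Fin.cases with
    | zero => simp at hij
    | succ i =>
      rw [coface_succ_succ]
      exact consMap_comp_counitAt_zero H _
  | succ n ih =>
    cases i using Fin.cases with
    | zero => simp at hij
    | succ i =>
      rw [coface_succ_succ]
      cases j using Fin.cases with
      | zero => exact consMap_comp_counitAt_zero H _
      | succ j =>
        rw [← Fin.succ_castSucc, Fin.succ_lt_succ_iff] at hij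
        cases i using Fin.cases with
        | zero => simp at hij
        | succ i =>
          rw [← Fin.succ_castSucc, counitAt_succ, counitAt_succ, ← consMap_comp, ih _ _ hij,
            coface_succ_succ, consMap_comp]

end Coface

end BraidedHopf

namespace BraidedHopf

variable {C : Type u} [Category.{v} C] [MonoidalCategory C]

/-! ### Iterated comultiplications -/

/-- Generalized coassociativity: it does not matter which leg is split further. -/
lemma iterComul_comp_comulAt (H : C) [ComonObj H] (n : ℕ) (i : Fin (n + 1)) :
    iterComul H n ≫ comulAt H (n + 1) i = iterComul H (n + 1) := by
  induction n with
  | zero =>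
    obtain rfl := Fin.fin_one_eq_zero i
    have key : (ρ_ H).inv ≫ Δ[H] ▷ (𝟙_ C) ≫ (α_ H H (𝟙_ C)).hom = Δ[H] ≫ H ◁ (ρ_ H).inv := by
      monoidal
    exact key
  | succ n ih =>
    cases i using Fin.cases with
    | zero =>
      have key : ∀ {X : C} (f : H ⟶ X), (Δ[H] ≫ H ◁ f) ≫ Δ[H] ▷ X ≫ (α_ H H X).hom =
          Δ[H] ≫ H ◁ (Δ[H] ≫ H ◁ f) := by
        intro X f
        rw [Category.assoc, whisker_exchange_assoc, tensor_whiskerLeft, whiskerLeft_comp,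
          ComonObj.comul_assoc_assoc]
        simp
      exact key _
    | succ i =>
      have h := ih i
      refine Eq.trans (b := Δ[H] ≫ H ◁ (iterComul H n ≫ comulAt H (n + 1) i)) ?_ ?_
      · rw [whiskerLeft_comp]; exact Category.assoc _ _ _
      · rw [h]; rfl

lemma iterComul_comp_counitAt (H : C) [ComonObj H] (n : ℕ) (i : Fin (n + 2)) :
    iterComul H (n + 1) ≫ counitAt H (n + 1) i = iterComul H n := by
  induction n with
  | zero =>
    cases i using Fin.cases with
    | zero =>
      have key : (Δ[H] ≫ H ◁ (ρ_ H).inv) ≫ ε[H] ▷ (H ⊗ 𝟙_ C) ≫ (λ_ (H ⊗ 𝟙_ C)).hom =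
          (ρ_ H).inv := by
        rw [Category.assoc, whisker_exchange_assoc, ComonObj.counit_comul_assoc]
        monoidal
      exact key
    | succ i =>
      obtain rfl := Fin.fin_one_eq_zero i
      have key : (Δ[H] ≫ H ◁ (ρ_ H).inv) ≫ H ◁ (ε[H] ▷ (𝟙_ C) ≫ (λ_ (𝟙_ C)).hom) =
          (ρ_ H).inv := by
        calc _ = Δ[H] ≫ H ◁ ε[H] := by monoidal
          _ = _ := ComonObj.comul_counit H
      exact key
  | succ n ih =>
    cases i using Fin.cases with
    | zero =>
      have key : ∀ {X : C} (f : H ⟶ X), (Δ[H] ≫ H ◁ f) ≫ ε[H] ▷ X ≫ (λ_ X).hom = f := by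
        intro X f
        rw [Category.assoc, whisker_exchange_assoc, ComonObj.counit_comul_assoc]
        simp
      exact key _
    | succ i =>
      have h := ih i
      refine Eq.trans (b := Δ[H] ≫ H ◁ (iterComul H (n + 1) ≫ counitAt H (n + 1) i)) ?_ ?_
      · rw [whiskerLeft_comp]; exact Category.assoc _ _ _
      · rw [h]; rfl

variable [BraidedCategory C]

/-! ### The tensor powers as monoid objects -/

/-- The inductive form makes the standard facts on tensor products of algebra maps available for
tensor powers. -/
instance monObjTensorPow (H : C) [MonObj H] : (n : ℕ) → MonObj (tensorPow H n)
  | 0 => inferInstanceAs (MonObj (𝟙_ C))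
  | n + 1 =>
    letI := monObjTensorPow H n
    inferInstanceAs (MonObj (H ⊗ tensorPow H n))

lemma mulPow_eq_mul (H : C) [MonObj H] (n : ℕ) : mulPow H n = μ[tensorPow H n] := by
  induction n with
  | zero =>
    have : mulPow H 0 = (λ_ (𝟙_ C)).hom ≫ 𝟙 (𝟙_ C) ≫ 𝟙 (𝟙_ C) ≫ 𝟙 (𝟙_ C) := rfl
    rw [this, Category.comp_id, Category.comp_id, Category.comp_id]
    rfl
  | succ n ih => rw [mulPow_succ, ih]; rfl

instance isMonHom_consMap (H : C) [MonObj H] {m n : ℕ} (f : tensorPow H m ⟶ tensorPow H n)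
    [IsMonHom f] : IsMonHom (consMap H f) :=
  inferInstanceAs (IsMonHom (H ◁ f))

instance isMonHom_comul (H : C) [BimonObj H] : IsMonHom Δ[H] where
  one_hom := BimonObj.one_comul H
  mul_hom := BimonObj.mul_comul H

instance isMonHom_counit (H : C) [BimonObj H] : IsMonHom ε[H] where
  one_hom := BimonObj.one_counit H
  mul_hom := BimonObj.mul_counit H

instance isMonHom_iterComul (H : C) [BimonObj H] (n : ℕ) : IsMonHom (iterComul H n) := by
  induction n with
  | zero => exact inferInstanceAs (IsMonHom (ρ_ H).inv)
  | succ n ih => exact inferInstanceAs (IsMonHom (Δ[H] ≫ H ◁ iterComul H n))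

instance isMonHom_comulAt (H : C) [BimonObj H] (n : ℕ) (i : Fin n) : IsMonHom (comulAt H n i) := by
  induction n with
  | zero => exact i.elim0
  | succ n ih =>
    cases i using Fin.cases with
    | zero =>
      exact inferInstanceAs
        (IsMonHom (Δ[H] ▷ tensorPow H n ≫ (α_ H H (tensorPow H n)).hom))
    | succ i => exact isMonHom_consMap H _

instance isMonHom_counitAt (H : C) [BimonObj H] (n : ℕ) (i : Fin (n + 1)) :
    IsMonHom (counitAt H n i) := by
  induction n with
  | zero => exact inferInstanceAs
        (IsMonHom (ε[H] ▷ tensorPow H 0 ≫ (λ_ (tensorPow H 0)).hom))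
  | succ n ih =>
    cases i using Fin.cases with
    | zero =>
      exact inferInstanceAs
        (IsMonHom (ε[H] ▷ tensorPow H (n + 1) ≫ (λ_ (tensorPow H (n + 1))).hom))
    | succ i => exact isMonHom_consMap H _

/-! ### The twisted antipode -/

section TwistedAntipode

variable (H : C) [HopfObj H]

/-- The translation `(δ ⊗ 1) Δ : H ⟶ H` by a form `δ`. -/
def translate (δ : H ⟶ 𝟙_ C) : H ⟶ H :=
  Δ[H] ≫ δ ▷ H ≫ (λ_ H).hom

/-- Translation affects only the first leg of `Δ` and is an algebra map when `δ` is a character, so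
properties of `S̃` follow from those of `S`. -/
lemma twistedAntipode_eq (δ : H ⟶ 𝟙_ C) :
    twistedAntipode H δ = translate H δ ≫ 𝒮[H] := by
  simp [twistedAntipode, translate, MonoidalCategory.tensorHom_def]

lemma translate_comp_comul (δ : H ⟶ 𝟙_ C) :
    translate H δ ≫ Δ[H] = Δ[H] ≫ translate H δ ▷ H := by
  unfold translate
  calc _ = Δ[H] ≫ (δ ▷ H ≫ 𝟙_ C ◁ Δ[H]) ≫ (λ_ (H ⊗ H)).hom := by monoidal
    _ = (Δ[H] ≫ H ◁ Δ[H]) ≫ δ ▷ (H ⊗ H) ≫ (λ_ (H ⊗ H)).hom := by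
      rw [← whisker_exchange]; monoidal
    _ = _ := by rw [ComonObj.comul_assoc]; monoidal

lemma translate_comp_counit (δ : H ⟶ 𝟙_ C) : translate H δ ≫ ε[H] = δ := by
  unfold translate
  calc _ = Δ[H] ≫ (δ ▷ H ≫ 𝟙_ C ◁ ε[H]) ≫ (λ_ (𝟙_ C)).hom := by monoidal
    _ = (Δ[H] ≫ H ◁ ε[H]) ≫ δ ▷ (𝟙_ C) ≫ (λ_ (𝟙_ C)).hom := by
      rw [← whisker_exchange]; monoidal
    _ = _ := by rw [ComonObj.comul_counit]; monoidal

/-- The form `δ` sits on the first leg of `Δ`, which the braiding moves to second place; hence the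
twist survives only there. -/
lemma twistedAntipode_comp_comul (δ : H ⟶ 𝟙_ C) :
    twistedAntipode H δ ≫ Δ[H] = Δ[H] ≫ (β_ H H).hom ≫ (𝒮[H] ⊗ₘ twistedAntipode H δ) := by
  rw [twistedAntipode_eq, Category.assoc, HopfObj.antipode_comul, ← Category.assoc,
    translate_comp_comul, Category.assoc, BraidedCategory.braiding_naturality_left_assoc]
  simp [MonoidalCategory.tensorHom_def']

lemma comul_comp_twistedAntipode_mul (δ : H ⟶ 𝟙_ C) :
    Δ[H] ≫ twistedAntipode H δ ▷ H ≫ μ[H] = δ ≫ η[H] := by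
  rw [twistedAntipode_eq, comp_whiskerRight, Category.assoc, ← Category.assoc Δ[H],
    ← translate_comp_comul, Category.assoc, HopfObj.antipode_left, ← Category.assoc,
    translate_comp_counit]

lemma twistedAntipode_comp_counit (δ : H ⟶ 𝟙_ C) : twistedAntipode H δ ≫ ε[H] = δ := by
  rw [twistedAntipode_eq, Category.assoc, HopfObj.antipode_counit, translate_comp_counit]

variable {H} {δ : H ⟶ 𝟙_ C}

lemma IsCharacter.isMonHom (hδ : IsCharacter H δ) : IsMonHom δ where
  one_hom := hδ.one
  mul_hom := hδ.mul

lemma IsCharacter.isMonHom_translate (hδ : IsCharacter H δ) : IsMonHom (translate H δ) := by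
  have := hδ.isMonHom
  unfold translate
  infer_instance

lemma IsCharacter.one_comp_twistedAntipode (hδ : IsCharacter H δ) :
    η[H] ≫ twistedAntipode H δ = η[H] := by
  have := hδ.isMonHom_translate
  rw [twistedAntipode_eq, IsMonHom.one_hom_assoc, HopfObj.one_antipode]

lemma IsCharacter.mul_comp_twistedAntipode (hδ : IsCharacter H δ) :
    μ[H] ≫ twistedAntipode H δ =
      (twistedAntipode H δ ⊗ₘ twistedAntipode H δ) ≫ (β_ H H).hom ≫ μ[H] := by
  have := hδ.isMonHom_translate
  rw [twistedAntipode_eq, IsMonHom.mul_hom_assoc, HopfObj.mul_antipode,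
    tensorHom_comp_tensorHom_assoc]

/-- Multiplicativity of `δ` gives `δ(h₁) δ(S h₂) = δ(h₁ S h₂) = ε(h)`. -/
lemma IsCharacter.twistedAntipode_comp (hδ : IsCharacter H δ) :
    twistedAntipode H δ ≫ δ = ε[H] := by
  have := hδ.isMonHom
  have h : Δ[H] ≫ H ◁ 𝒮[H] ≫ μ[H] ≫ δ = ε[H] := by
    rw [HopfObj.antipode_right_assoc, hδ.one, Category.comp_id]
  rw [← h, hδ.mul, twistedAntipode, MonoidalCategory.tensorHom_def' δ 𝒮[H],
    MonoidalCategory.tensorHom_def δ δ]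
  monoidal

end TwistedAntipode

end BraidedHopf

namespace BraidedHopf

variable {C : Type u} [Category.{v} C] [MonoidalCategory C] [BraidedCategory C]

/-! ### The cyclic operators -/

/-- The product `m (f ⊗ g)` of morphisms into a tensor power. -/
def pairMul (H : C) [MonObj H] {m n : ℕ} (f : H ⟶ tensorPow H m)
    (g : tensorPow H n ⟶ tensorPow H m) : tensorPow H (n + 1) ⟶ tensorPow H m :=
  (f ⊗ₘ g) ≫ μ[tensorPow H m]

lemma pairMul_comp (H : C) [MonObj H] {l m n : ℕ} (f : H ⟶ tensorPow H m)
    (g : tensorPow H n ⟶ tensorPow H m) (h : tensorPow H m ⟶ tensorPow H l) [IsMonHom h] :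
    pairMul H f g ≫ h = pairMul H (f ≫ h) (g ≫ h) := by
  have key : ∀ {X Y A B : C} [MonObj A] [MonObj B] (f : X ⟶ A) (g : Y ⟶ A) (h : A ⟶ B)
      [IsMonHom h], ((f ⊗ₘ g) ≫ μ[A]) ≫ h = ((f ≫ h) ⊗ₘ (g ≫ h)) ≫ μ[B] := by
    intros
    rw [Category.assoc, IsMonHom.mul_hom, tensorHom_comp_tensorHom_assoc]
  exact key f g h

lemma consMap_comp_pairMul (H : C) [MonObj H] {k m n : ℕ} (h : tensorPow H k ⟶ tensorPow H n)
    (f : H ⟶ tensorPow H m) (g : tensorPow H n ⟶ tensorPow H m) :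
    consMap H h ≫ pairMul H f g = pairMul H f (h ≫ g) := by
  have key : ∀ {X Y Z A : C} [MonObj A] (f : X ⟶ A) (g : Y ⟶ A) (h : Z ⟶ Y),
      X ◁ h ≫ (f ⊗ₘ g) ≫ μ[A] = (f ⊗ₘ (h ≫ g)) ≫ μ[A] := by
    intros
    simp [MonoidalCategory.tensorHom_def']
  exact key f g h

lemma unitFirst_comp_pairMul (H : C) [MonObj H] {m n : ℕ}
    (f : H ⟶ tensorPow H m) (g : tensorPow H n ⟶ tensorPow H m)
    (hf : η[H] ≫ f = η[tensorPow H m]) : unitFirst H n ≫ pairMul H f g = g := by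
  have key : ∀ {Y A : C} [MonObj A] (f : H ⟶ A) (g : Y ⟶ A), η[H] ≫ f = η[A] →
      ((λ_ Y).inv ≫ η[H] ▷ Y) ≫ (f ⊗ₘ g) ≫ μ[A] = g := by
    intro Y A _ f g h
    rw [MonoidalCategory.tensorHom_def, Category.assoc, Category.assoc,
      ← comp_whiskerRight_assoc, h, ← whisker_exchange_assoc, MonObj.one_mul]
    simp
  exact key f g hf

lemma cyclicOp_succ (H : C) [HopfObj H] (δ : H ⟶ 𝟙_ C) (σ : 𝟙_ C ⟶ H) (n : ℕ) :
    cyclicOp H δ σ (n + 1) =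
      pairMul H (twistedAntipode H δ ≫ iterComul H n) (appendLast H σ n) := by
  unfold pairMul
  rw [← mulPow_eq_mul]
  rfl

/-! ### Antipode cancellations in braided tensor products -/

section

variable (H : C) [HopfObj H]

/-- The two crossings carry `h₁` past `h₂ ⊗ h₃`; by naturality `S(h₂) h₃` may be contracted to
`ε(h₂) η` before the crossing. -/
lemma comul_comul_braiding_antipode :
    Δ[H] ≫ Δ[H] ▷ H ≫ (β_ H H).hom ▷ H ≫ (α_ H H H).hom ≫ H ◁ (β_ H H).hom ≫
      (α_ H H H).inv ≫ (𝒮[H] ▷ H ≫ μ[H]) ▷ H = (λ_ H).inv ≫ η[H] ▷ H := by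
  calc _ = (Δ[H] ≫ Δ[H] ▷ H ≫ (α_ H H H).hom) ≫ (β_ H (H ⊗ H)).hom ≫
        (𝒮[H] ▷ H ≫ μ[H]) ▷ H := by
        rw [BraidedCategory.braiding_tensor_right_hom]; simp
    _ = Δ[H] ≫ H ◁ (Δ[H] ≫ 𝒮[H] ▷ H ≫ μ[H]) ≫ (β_ H H).hom := by
        rw [← ComonObj.comul_assoc, ← BraidedCategory.braiding_naturality_right]
        simp only [Category.assoc, whiskerLeft_comp]
    _ = _ := by
        rw [HopfObj.antipode_left, whiskerLeft_comp, Category.assoc,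
          ComonObj.comul_counit_assoc, BraidedCategory.braiding_naturality_right]
        simp

/-- The core of `τ δ_1 = δ_0 τ`, for `f = Δ^n S̃`: the product has components `S(h₂) h₃` and `f(h₁)
a(x)`, and the first collapses. -/
lemma comulHead_comp_mul {X A : C} [MonObj A] (f : H ⟶ A) (a : X ⟶ A) :
    (Δ[H] ▷ X ≫ (α_ H H X).hom) ≫ ((Δ[H] ≫ (β_ H H).hom ≫ (𝒮[H] ⊗ₘ f)) ⊗ₘ (H ◁ a)) ≫
      tensorμ H A H A ≫ (μ[H] ⊗ₘ μ[A]) =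
      ((f ⊗ₘ a) ≫ μ[A]) ≫ (λ_ A).inv ≫ η[H] ▷ A := by
  have h1 : ((Δ[H] ≫ (β_ H H).hom ≫ (𝒮[H] ⊗ₘ f)) ⊗ₘ (H ◁ a)) ≫
      tensorμ H A H A ≫ (μ[H] ⊗ₘ μ[A]) = (Δ[H] ≫ (β_ H H).hom) ▷ (H ⊗ X) ≫
        tensorμ H H H X ≫ ((𝒮[H] ▷ H ≫ μ[H]) ⊗ₘ ((f ⊗ₘ a) ≫ μ[A])) := by
    have : ((Δ[H] ≫ (β_ H H).hom ≫ (𝒮[H] ⊗ₘ f)) ⊗ₘ (H ◁ a)) =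
        (Δ[H] ≫ (β_ H H).hom) ▷ (H ⊗ X) ≫ ((𝒮[H] ⊗ₘ f) ⊗ₘ (𝟙 H ⊗ₘ a)) := by
      rw [← tensorHom_id, tensorHom_comp_tensorHom]; simp
    rw [this, Category.assoc, tensorμ_natural_assoc, tensorHom_comp_tensorHom, tensorHom_id]
  have h2 : (Δ[H] ▷ X ≫ (α_ H H X).hom) ≫ (Δ[H] ≫ (β_ H H).hom) ▷ (H ⊗ X) ≫
      tensorμ H H H X ≫ (𝒮[H] ▷ H ≫ μ[H]) ▷ (H ⊗ X) = (λ_ (H ⊗ X)).inv ≫ η[H] ▷ (H ⊗ X) := by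
    calc _ = (Δ[H] ≫ Δ[H] ▷ H ≫ (β_ H H).hom ▷ H ≫ (α_ H H H).hom ≫ H ◁ (β_ H H).hom ≫
        (α_ H H H).inv ≫ (𝒮[H] ▷ H ≫ μ[H]) ▷ H) ▷ X ≫ (α_ H H X).hom := by
          rw [tensorμ]; monoidal
      _ = _ := by rw [comul_comul_braiding_antipode]; monoidal
  rw [h1, MonoidalCategory.tensorHom_def]
  have h3 := congrArg (· ≫ H ◁ ((f ⊗ₘ a) ≫ μ[A])) h2
  simp only [Category.assoc] at h3 ⊢
  rw [h3, ← whisker_exchange]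
  simp

variable {H} {δ : H ⟶ 𝟙_ C}

/-- The core of `τ σ_0 = σ_n τ²`. With `w = D S̃` and crossings suppressed, `w(h₁ k) D(h₂) a(x) =
w(k) w(h₁) D(h₂) a(x) = δ(h) w(k) a(x)`. -/
lemma IsCharacter.comul_tensor_comp_mul (hδ : IsCharacter H δ) {X A : C} [MonObj A] (D : H ⟶ A)
    [IsMonHom D] (a : X ⟶ A) :
    ((Δ[H] ≫ H ◁ D) ⊗ₘ (H ◁ a)) ≫ (tensorμ H A H A ≫ (μ[H] ⊗ₘ μ[A])) ≫
      ((twistedAntipode H δ ≫ D) ⊗ₘ 𝟙 A) ≫ μ[A] =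
    (δ ▷ (H ⊗ X) ≫ (λ_ (H ⊗ X)).hom) ≫ ((twistedAntipode H δ ≫ D) ⊗ₘ a) ≫ μ[A] := by
  have hu : μ[H] ≫ twistedAntipode H δ ≫ D = (β_ H H).hom ≫
      ((twistedAntipode H δ ≫ D) ⊗ₘ (twistedAntipode H δ ≫ D)) ≫ μ[A] := by
    rw [← Category.assoc, hδ.mul_comp_twistedAntipode]
    simp
  have hD : Δ[H] ≫ ((twistedAntipode H δ ≫ D) ⊗ₘ D) ≫ μ[A] = δ ≫ η[A] := by
    have := congrArg (· ≫ D) (comul_comp_twistedAntipode_mul H δ)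
    simp only [Category.assoc, IsMonHom.mul_hom, IsMonHom.one_hom] at this
    rw [← this]
    simp [MonoidalCategory.tensorHom_def]
  -- Only the reversal of products and the cancellation against `D` matter from here on.
  generalize twistedAntipode H δ ≫ D = w at hu hD ⊢
  -- The crossing of `h₂` in `tensorμ` and that of `h₁` from `hu` form the braiding of `H ⊗ H` with
  -- `H`, so `Δ` can be postponed until after a single crossing.
  have hbr : Δ[H] ▷ (H ⊗ X) ≫ tensorμ H H H X ≫ (β_ H H).hom ▷ (H ⊗ X) =
      (α_ H H X).inv ≫ (β_ H H).hom ▷ X ≫ (α_ H H X).hom ≫ H ◁ Δ[H] ▷ X ≫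
        H ◁ (α_ H H X).hom ≫ (α_ H H (H ⊗ X)).inv := by
    have h := BraidedCategory.braiding_naturality_left Δ[H] H
    rw [BraidedCategory.braiding_tensor_left_hom] at h
    calc _ = (α_ H H X).inv ≫ (Δ[H] ▷ H ≫ (α_ H H H).hom ≫ H ◁ (β_ H H).hom ≫
          (α_ H H H).inv ≫ (β_ H H).hom ▷ H ≫ (α_ H H H).hom) ▷ X ≫ (α_ H (H ⊗ H) X).hom ≫
            H ◁ (α_ H H X).hom ≫ (α_ H H (H ⊗ X)).inv := by
          rw [tensorμ]; monoidal
      _ = _ := by rw [h]; monoidal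
  have hassoc : (α_ H H (H ⊗ X)).inv ≫ (((w ⊗ₘ w) ≫ μ[A]) ⊗ₘ ((D ⊗ₘ a) ≫ μ[A])) ≫ μ[A] =
      H ◁ (α_ H H X).inv ≫ (w ⊗ₘ ((((w ⊗ₘ D) ≫ μ[A]) ⊗ₘ a) ≫ μ[A])) ≫ μ[A] := by
    have h : (μ[A] ⊗ₘ μ[A]) ≫ μ[A] =
        (α_ A A (A ⊗ A)).hom ≫ A ◁ ((α_ A A A).inv ≫ μ[A] ▷ A ≫ μ[A]) ≫ μ[A] := by
      rw [MonObj.mul_assoc A, Iso.inv_hom_id_assoc, MonoidalCategory.tensorHom_def',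
        Category.assoc, MonObj.mul_assoc A]
      simp
    have h' : ((w ⊗ₘ w) ⊗ₘ (D ⊗ₘ a)) ≫ (α_ A A (A ⊗ A)).hom ≫ A ◁ (α_ A A A).inv =
        (α_ H H (H ⊗ X)).hom ≫ H ◁ (α_ H H X).inv ≫ (w ⊗ₘ ((w ⊗ₘ D) ⊗ₘ a)) := by
      rw [associator_naturality_assoc, ← id_tensorHom, ← id_tensorHom, tensorHom_comp_tensorHom,
        tensorHom_comp_tensorHom, associator_inv_naturality]
      simp
    have h'' := congrArg (· ≫ A ◁ (μ[A] ▷ A ≫ μ[A]) ≫ μ[A]) h'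
    simp only [Category.assoc] at h''
    rw [← tensorHom_comp_tensorHom, Category.assoc, h, whiskerLeft_comp, Category.assoc,
      h'', Iso.inv_hom_id_assoc]
    congr 1
    simp only [← id_tensorHom, ← tensorHom_id, tensorHom_comp_tensorHom_assoc,
      Category.comp_id]
  calc _ = (Δ[H] ▷ (H ⊗ X) ≫ tensorμ H H H X ≫ (β_ H H).hom ▷ (H ⊗ X)) ≫
        (((w ⊗ₘ w) ≫ μ[A]) ⊗ₘ ((D ⊗ₘ a) ≫ μ[A])) ≫ μ[A] := by
        have h : ((Δ[H] ≫ H ◁ D) ⊗ₘ (H ◁ a)) =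
            Δ[H] ▷ (H ⊗ X) ≫ ((𝟙 H ⊗ₘ D) ⊗ₘ (𝟙 H ⊗ₘ a)) := by
          rw [← tensorHom_id, tensorHom_comp_tensorHom]; simp
        rw [h]
        simp only [Category.assoc]
        rw [tensorμ_natural_assoc, tensorHom_comp_tensorHom_assoc, tensorHom_comp_tensorHom_assoc,
          ← tensorHom_id (β_ H H).hom, tensorHom_comp_tensorHom_assoc, ← hu]
        simp
    _ = (α_ H H X).inv ≫ (β_ H H).hom ▷ X ≫ (α_ H H X).hom ≫
          (w ⊗ₘ (((Δ[H] ≫ (w ⊗ₘ D) ≫ μ[A]) ⊗ₘ a) ≫ μ[A])) ≫ μ[A] := by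
        rw [hbr]
        simp only [Category.assoc]
        rw [hassoc, whiskerLeft_hom_inv_assoc, ← id_tensorHom, ← tensorHom_id Δ[H],
          tensorHom_comp_tensorHom_assoc, tensorHom_comp_tensorHom_assoc]
        simp
    _ = (α_ H H X).inv ≫ (β_ H H).hom ▷ X ≫ (α_ H H X).hom ≫
          (w ⊗ₘ (δ ▷ X ≫ (λ_ X).hom ≫ a)) ≫ μ[A] := by
        have h : ((δ ≫ η[A]) ⊗ₘ a) ≫ μ[A] = δ ▷ X ≫ (λ_ X).hom ≫ a := by
          rw [MonoidalCategory.tensorHom_def, comp_whiskerRight, Category.assoc, Category.assoc,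
            ← whisker_exchange_assoc, MonObj.one_mul, leftUnitor_naturality]
        rw [hD, h]
    _ = (α_ H H X).inv ≫ ((β_ H H).hom ≫ H ◁ δ) ▷ X ≫ (ρ_ H).hom ▷ X ≫ (w ⊗ₘ a) ≫ μ[A] := by
        rw [MonoidalCategory.tensorHom_def', MonoidalCategory.tensorHom_def']
        monoidal
    _ = _ := by
        rw [← BraidedCategory.braiding_naturality_left, braiding_tensorUnit_left]
        monoidal

lemma IsCharacter.twistedAntipode_comul_tensor_comp_mul (hδ : IsCharacter H δ) {X A : C}
    [MonObj A] (D : H ⟶ A) [IsMonHom D] (a : X ⟶ A) :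
    (((twistedAntipode H δ ≫ Δ[H] ≫ H ◁ D) ⊗ₘ (H ◁ a)) ≫ tensorμ H A H A ≫ (μ[H] ⊗ₘ μ[A])) ≫
      ((twistedAntipode H δ ≫ D) ⊗ₘ 𝟙 A) ≫ μ[A] =
    (ε[H] ▷ (H ⊗ X) ≫ (λ_ (H ⊗ X)).hom) ≫ ((twistedAntipode H δ ≫ D) ⊗ₘ a) ≫ μ[A] := by
  have h := congrArg (twistedAntipode H δ ▷ (H ⊗ X) ≫ ·) (hδ.comul_tensor_comp_mul D a)
  simp only [Category.assoc] at h ⊢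
  rw [← comp_whiskerRight_assoc, hδ.twistedAntipode_comp] at h
  rw [← h, ← tensorHom_id, tensorHom_comp_tensorHom_assoc (twistedAntipode H δ),
    Category.id_comp]

end

end BraidedHopf

namespace BraidedHopf

variable {C : Type u} [Category.{v} C] [MonoidalCategory C] [BraidedCategory C]

/-! ### Cyclic operators against cofaces and codegeneracies -/

section CyclicOp

variable {H : C} [HopfObj H] {δ : H ⟶ 𝟙_ C} {σ : 𝟙_ C ⟶ H}

lemma IsCharacter.coface_zero_comp_cyclicOp (hδ : IsCharacter H δ) (n : ℕ) :
    coface H σ n 0 ≫ cyclicOp H δ σ (n + 1) = coface H σ n (Fin.last (n + 1)) := by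
  rw [coface_zero, coface_last, cyclicOp_succ, unitFirst_comp_pairMul]
  rw [← Category.assoc, hδ.one_comp_twistedAntipode, IsMonHom.one_hom]

lemma comulAt_zero_comp_cyclicOp (n : ℕ) :
    comulAt H (n + 1) 0 ≫ cyclicOp H δ σ (n + 2) =
      cyclicOp H δ σ (n + 1) ≫ unitFirst H (n + 1) := by
  have h : twistedAntipode H δ ≫ iterComul H (n + 1) =
      Δ[H] ≫ (β_ H H).hom ≫ (𝒮[H] ⊗ₘ (twistedAntipode H δ ≫ iterComul H n)) := by
    have key : ∀ {X : C} (f : H ⟶ X), twistedAntipode H δ ≫ Δ[H] ≫ H ◁ f =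
        Δ[H] ≫ (β_ H H).hom ≫ (𝒮[H] ⊗ₘ (twistedAntipode H δ ≫ f)) := by
      intro X f
      rw [← Category.assoc, twistedAntipode_comp_comul]
      simp [MonoidalCategory.tensorHom_def]
    exact key _
  rw [cyclicOp_succ, cyclicOp_succ, h]
  exact comulHead_comp_mul H _ _

/-- As `σ` is group-like, `S̃(σ) σ` is the value at `σ` of `S̃(h₁) h₂ = δ(h) η`. -/
lemma appendLast_zero_comp_cyclicOp (hσ : IsCocharacter H σ) (h : σ ≫ δ = 𝟙 (𝟙_ C)) :
    appendLast H σ 0 ≫ cyclicOp H δ σ 1 = unitFirst H 0 := by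
  have key : (σ ≫ (ρ_ H).inv) ≫ (twistedAntipode H δ ⊗ₘ σ) ≫ μ[H] = η[H] := by
    calc _ = ((λ_ (𝟙_ C)).inv ≫ (σ ⊗ₘ σ)) ≫ twistedAntipode H δ ▷ H ≫ μ[H] := by
          rw [MonoidalCategory.tensorHom_def' (twistedAntipode H δ) σ,
            MonoidalCategory.tensorHom_def σ σ]
          monoidal
      _ = _ := by
          rw [← hσ.comul, Category.assoc, comul_comp_twistedAntipode_mul, ← Category.assoc, h,
            Category.id_comp]
  have hD : ∀ {X A : C} [MonObj A] (D : H ⟶ A) [IsMonHom D] (f : X ⟶ H) (a : 𝟙_ C ⟶ H),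
    ((f ≫ D) ⊗ₘ (a ≫ D)) ≫ μ[A] = ((f ⊗ₘ a) ≫ μ[H]) ≫ D := by
    intros
    rw [Category.assoc, IsMonHom.mul_hom, tensorHom_comp_tensorHom_assoc]
  rw [cyclicOp_succ]
  refine Eq.trans (congrArg ((σ ≫ (ρ_ H).inv) ≫ ·)
    (hD (iterComul H 0) (twistedAntipode H δ) σ)) ?_
  refine (Category.assoc _ _ _).symm.trans <| (congrArg (· ≫ iterComul H 0) key).trans ?_
  have : η[H] ≫ (ρ_ H).inv = (λ_ (𝟙_ C)).inv ≫ η[H] ▷ (𝟙_ C) := by monoidal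
  exact this

lemma IsModularPairInInvolution.coface_succ_comp_cyclicOp
    (h : IsModularPairInInvolution H δ σ) (n : ℕ) (i : Fin (n + 1)) :
    coface H σ n i.succ ≫ cyclicOp H δ σ (n + 1) =
      cyclicOp H δ σ n ≫ coface H σ n i.castSucc := by
  cases n with
  | zero =>
    obtain rfl := Fin.fin_one_eq_zero i
    exact (appendLast_zero_comp_cyclicOp h.cocharacter h.modular).trans
      (Category.id_comp _).symm
  | succ n =>
    cases i using Fin.cases with
    | zero =>
      rw [coface_succ_zero, comulAt_zero_comp_cyclicOp]; rfl
    | succ k =>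
      -- Appending `σ` first turns the remaining coface, even the last one, into a comultiplication
      -- on a factor, which is an algebra map.
      have hd := h.cocharacter.coface_comp_coface H n k.succ (Fin.last (n + 1)) (Fin.le_last _)
      rw [Fin.succ_last, coface_last, coface_last, ← Fin.succ_castSucc,
        coface_castSucc_succ] at hd
      rw [coface_succ_succ, ← Fin.succ_castSucc, coface_castSucc_succ, cyclicOp_succ,
        cyclicOp_succ, consMap_comp_pairMul, hd, pairMul_comp, Category.assoc,
        iterComul_comp_comulAt]

lemma counitAt_succ_comp_cyclicOp (n : ℕ) (i : Fin n) :
    counitAt H n i.succ ≫ cyclicOp H δ σ n =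
      cyclicOp H δ σ (n + 1) ≫ counitAt H n i.castSucc := by
  cases n with
  | zero => exact i.elim0
  | succ n =>
    have hd := coface_comp_counitAt_of_gt H (σ := σ) n (Fin.last (n + 1)) i (Fin.castSucc_lt_last i)
    rw [Fin.succ_last, coface_last, coface_last] at hd
    rw [counitAt_succ, cyclicOp_succ, cyclicOp_succ, consMap_comp_pairMul, ← hd, pairMul_comp,
      Category.assoc, iterComul_comp_counitAt]

/-- The last counit is an algebra map and removes the appended `σ`, since `ε σ = 1`. -/
lemma IsCocharacter.cyclicOp_comp_counitAt_last (hσ : IsCocharacter H σ) (n : ℕ) :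
    cyclicOp H δ σ (n + 1) ≫ counitAt H n (Fin.last n) =
      pairMul H (twistedAntipode H δ ≫ iterComul H n ≫ counitAt H n (Fin.last n))
        (𝟙 (tensorPow H n)) := by
  have h := hσ.coface_succ_comp_counitAt H n (Fin.last n)
  rw [Fin.succ_last, coface_last] at h
  rw [cyclicOp_succ, pairMul_comp, h, Category.assoc]

lemma iterComul_zero_comp_pairMul_id (f : H ⟶ tensorPow H 0) :
    iterComul H 0 ≫ pairMul H f (𝟙 (tensorPow H 0)) = f := by
  have key : ∀ f : H ⟶ 𝟙_ C, (ρ_ H).inv ≫ (f ⊗ₘ 𝟙 (𝟙_ C)) ≫ (λ_ (𝟙_ C)).hom = f := by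
    intro f
    rw [tensorHom_id]
    monoidal
  exact key f

lemma counitAt_zero_eq_pairMul :
    counitAt H 0 0 = pairMul H (m := 0) (n := 0) ε[H] (𝟙 (tensorPow H 0)) := by
  have key : ε[H] ▷ (𝟙_ C) ≫ (λ_ (𝟙_ C)).hom = (ε[H] ⊗ₘ 𝟙 (𝟙_ C)) ≫ (λ_ (𝟙_ C)).hom := by
    rw [tensorHom_id]
  exact key

lemma IsCharacter.isMonHom_pairMul_id (hδ : IsCharacter H δ) :
    IsMonHom (pairMul H (m := 0) (n := 0) δ (𝟙 (tensorPow H 0))) := by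
  have := hδ.isMonHom
  exact inferInstanceAs (IsMonHom ((δ ⊗ₘ 𝟙 (𝟙_ C)) ≫ (λ_ (𝟙_ C)).hom))

/-- The value is `δ(S̃ h) δ(σ) = ε(h)`. Writing `δ` on `H ⊗ I` as a `pairMul` exhibits it as an
algebra map. -/
lemma IsModularPairInInvolution.cyclicOp_one_comp_pairMul
    (h : IsModularPairInInvolution H δ σ) :
    cyclicOp H δ σ 1 ≫ pairMul H (m := 0) (n := 0) δ (𝟙 (tensorPow H 0)) = counitAt H 0 0 := by
  have := h.character.isMonHom_pairMul_id
  have h1 : appendLast H σ 0 ≫ pairMul H (m := 0) (n := 0) δ (𝟙 (tensorPow H 0)) =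
      𝟙 (tensorPow H 0) := by
    exact (Category.assoc _ _ _).trans
      ((congrArg (σ ≫ ·) (iterComul_zero_comp_pairMul_id δ)).trans h.modular)
  have h2 : iterComul H 0 ≫ pairMul H (m := 0) (n := 0) δ (𝟙 (tensorPow H 0)) = δ :=
    iterComul_zero_comp_pairMul_id δ
  have h3 := h.character.twistedAntipode_comp
  rw [counitAt_zero_eq_pairMul, ← h3]
  refine (cyclicOp_succ H δ σ 0 ▸ pairMul_comp H _ _ _).trans ?_
  rw [h1, Category.assoc, h2]
  rfl

lemma IsModularPairInInvolution.counitAt_zero_comp_cyclicOp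
    (h : IsModularPairInInvolution H δ σ) (n : ℕ) :
    counitAt H n 0 ≫ cyclicOp H δ σ n =
      cyclicOp H δ σ (n + 1) ≫ cyclicOp H δ σ (n + 1) ≫ counitAt H n (Fin.last n) := by
  rw [h.cocharacter.cyclicOp_comp_counitAt_last]
  cases n with
  | zero =>
    -- In degree `0` no coproduct leg is left to absorb the counit, so `ε S̃ = δ` enters instead.
    have h1 : twistedAntipode H δ ≫ iterComul H 0 ≫ counitAt H 0 (Fin.last 0) = δ := by
      have : iterComul H 0 ≫ counitAt H 0 (Fin.last 0) = ε[H] := by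
        refine (congrArg (iterComul H 0 ≫ ·) (counitAt_zero_eq_pairMul (H := H))).trans ?_
        exact iterComul_zero_comp_pairMul_id (H := H) _
      rw [this]
      exact twistedAntipode_comp_counit H δ
    rw [h1]
    exact (Category.comp_id _).trans h.cyclicOp_one_comp_pairMul.symm
  | succ n =>
    rw [iterComul_comp_counitAt, cyclicOp_succ H δ σ n, cyclicOp_succ, counitAt_zero]
    exact (h.character.twistedAntipode_comul_tensor_comp_mul (iterComul H n)
      (appendLast H σ n)).symm

end CyclicOp

end BraidedHopf

theorem mainTheorem2 {C : Type u} [Category.{v} C] [MonoidalCategory C] [BraidedCategory C]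
    (H : C) [HopfObj H] (δ : H ⟶ 𝟙_ C) (σ : 𝟙_ C ⟶ H)
    (hδσ : BraidedHopf.IsModularPairInInvolution H δ σ) :
    IsParaCocyclic (BraidedHopf.tensorPow H) (BraidedHopf.coface H σ)
      (BraidedHopf.codegeneracy H) (BraidedHopf.cyclicOp H δ σ) where
  d_comp_d := hδσ.cocharacter.coface_comp_coface H
  d_comp_s_of_le := BraidedHopf.coface_comp_counitAt_of_le H
  d_comp_s_self := BraidedHopf.coface_castSucc_comp_counitAt H
  d_comp_s_succ := hδσ.cocharacter.coface_succ_comp_counitAt H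
  d_comp_s_of_gt := BraidedHopf.coface_comp_counitAt_of_gt H
  s_comp_s := BraidedHopf.counitAt_comp_counitAt H
  d_zero_comp_t := hδσ.character.coface_zero_comp_cyclicOp
  d_succ_comp_t := hδσ.coface_succ_comp_cyclicOp
  s_zero_comp_t := hδσ.counitAt_zero_comp_cyclicOp
  s_succ_comp_t := BraidedHopf.counitAt_succ_comp_cyclicOp
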